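/- Let $\kappa\ge 2$ and let $\Sigma=\{1,\dots,\kappa\}^{\mathbb N}$ be equipped with the left shift $\sigma$ and the metric in which two different words have distance $2^{-n}$, $n$ being the first place where they differ. For an infinite word $\mathtt i$ write $\mathtt i|_n$ for its first $n$ letters; for a finite word $\mathtt w$ let $[\mathtt w]$ be the set of infinite words starting with $\mathtt w$; for $\Gamma\subset\Sigma$ let $\Gamma_*=\{\mathtt i|_n:\mathtt i\in\Gamma,\ n\ge 0\}$. Let $X\subset\mathbb R^d$ be closed and let $\{\varphi_i\}_{i=1}^\kappa$ be a conformal iterated function system on $X$, that is: each $\varphi_i\colon X\to X$ is injective and a Lipschitz contraction (with constant $<1$) for the Euclidean distance, two of the maps have distinct fixed points, and there is an open set $V\supset X$ such that each $\varphi_i$ extends to an injective map $V\to\mathbb R^d$ that is differentiable with derivative a non-zero multiple of a linear isometry at every point of $V$, the derivative being locally Hölder continuous on $V$ with some exponent $\varepsilon>0$. Write $\varphi_{\mathtt w}=\varphi_{w_1}\circ\cdots\circ\varphi_{w_n}$ for $\mathtt w=w_1\cdots w_n$. Let $\Gamma\subset\Sigma$ be compact with $\sigma(\Gamma)\subset\Gamma$,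 and let $W\subset X$ be such that $\{\varphi_{\mathtt w}(W):\mathtt w\in\Gamma_*\}$ is a Moran construction, that is: these sets are closed and bounded with positive diameter, $\varphi_{\mathtt w}(W)\subset\varphi_{\mathtt w^-}(W)$ for all non-empty $\mathtt w\in\Gamma_*$, where $\mathtt w^-$ is $\mathtt w$ without its last letter, and $\operatorname{diam}\varphi_{\mathtt i|_n}(W)\to 0$ as $n\to\infty$ for all $\mathtt i\in\Gamma$. Let $\pi\colon\Gamma\to X$ be the projection given by $\{\pi(\mathtt i)\}=\bigcap_{n=1}^\infty\varphi_{\mathtt i|_n}(W)$. A miniset of $A\subset\Gamma$ is a set of the form $\sigma^{|\mathtt w|}(A\cap[\mathtt w])$ with $\mathtt w$ a finite word, and a microset of a compact set $A\subset\Gamma$ is a compact set $A'\subset\Gamma$ that is the limit, in the Hausdorff metric, of a sequence of minisets of $A$. The Assouad dimension $\dim_A(S)$ of a set $S$ is the infimum of all $t\ge 0$ for which there is a constant $C\ge 1$ such that, for every point $x$ of the ambient space and all $0<r<R$, the set $S\cap B(x,R)$ can be covered by at most $C(r/R)^{-t}$ closed balls of radius $r$ centered at $S$; in particular $\dim_A(\emptyset)=0$.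 Then for every compact set $A\subset\Gamma$, $$\dim_A(\pi(A))=\sup\{\dim_A(\pi(A')) : A'\text{ is a microset of }A\}.$$ -/

import Mathlib

open Set Filter Topology
open scoped NNReal ENNReal

namespace MoranMicro

/-! ### Shift space -/

/-- The shift space of infinite words over an alphabet with `κ` letters (letters are indexed
from `0`). -/
abbrev Shift (κ : ℕ) : Type := ℕ → Fin κ

/-- The usual ultrametric on the shift space: the distance of two different words is `2⁻ⁿ`,
where `n` is the first place (counted from `0`) at which they differ. -/
noncomputable instance shiftMetric (κ : ℕ) : MetricSpace (Shift κ) :=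
  PiNat.metricSpace

/-- The left shift. -/
def leftShift {κ : ℕ} (i : Shift κ) : Shift κ := fun n => i (n + 1)

/-- `pre i n` is the finite word formed by the first `n` letters of `i`. -/
def pre {κ : ℕ} (i : Shift κ) (n : ℕ) : List (Fin κ) := (List.range n).map i

/-- `words Γ` is the set of all finite words that are prefixes of elements of `Γ`. -/
def words {κ : ℕ} (Γ : Set (Shift κ)) : Set (List (Fin κ)) :=
  {w | ∃ i ∈ Γ, ∃ n : ℕ, w = pre i n}

/-- The cylinder set of all infinite words that start with `w`. -/
def cylinder {κ : ℕ} (w : List (Fin κ)) : Set (Shift κ) := {i | pre i w.length = w}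

/-- The symbolic magnification `σ^{|w|}(A ∩ [w])`. -/
def magnify {κ : ℕ} (w : List (Fin κ)) (A : Set (Shift κ)) : Set (Shift κ) :=
  leftShift^[w.length] '' (A ∩ cylinder w)

/-- `A'` is a miniset of `A`. -/
def IsMiniset {κ : ℕ} (A A' : Set (Shift κ)) : Prop :=
  ∃ w : List (Fin κ), A' = magnify w A

/-- `A'` is a microset of `A`: a compact subset of `Γ` that is the limit, in the Hausdorff metric,
of a sequence of minisets of `A`. (The extended Hausdorff distance of the empty set and a non-empty
set is infinite, so a sequence of sets tends to `∅` only if its members are eventually empty.) -/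
def IsMicroset {κ : ℕ} (Γ A A' : Set (Shift κ)) : Prop :=
  A' ⊆ Γ ∧ IsCompact A' ∧ ∃ B : ℕ → Set (Shift κ), (∀ n, IsMiniset A (B n)) ∧
    Tendsto (fun n => Metric.hausdorffEDist (B n) A') atTop (𝓝 0)

/-! ### Moran constructions -/

/-- The sets `E w`, where `w` runs through the finite words of `Γ`, form a Moran construction.
The values of `E` at other words are irrelevant. -/
structure IsMoranConstruction {κ : ℕ} {M : Type*} [MetricSpace M] (Γ : Set (Shift κ))
    (E : List (Fin κ) → Set M) : Prop where
  isClosed : ∀ w ∈ words Γ, IsClosed (E w)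
  isBounded : ∀ w ∈ words Γ, Bornology.IsBounded (E w)
  diam_pos : ∀ w ∈ words Γ, 0 < Metric.diam (E w)
  subset : ∀ w ∈ words Γ, w ≠ [] → E w ⊆ E w.dropLast
  diam_tendsto : ∀ i ∈ Γ, Tendsto (fun n => Metric.diam (E (pre i n))) atTop (𝓝 0)

/-- The projection: `proj E i` is the point of `⋂ n ≥ 1, E (i|ₙ)`. -/
noncomputable def proj {κ : ℕ} {M : Type*} [Nonempty M] (E : List (Fin κ) → Set M)
    (i : Shift κ) : M :=
  Classical.epsilon fun x => x ∈ ⋂ n : ℕ, E (pre i (n + 1))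

theorem pre_succ_ne_nil {κ : ℕ} (i : Shift κ) (n : ℕ) : pre i (n + 1) ≠ [] := by
  simp [pre]

theorem dropLast_pre_succ {κ : ℕ} (i : Shift κ) (n : ℕ) : (pre i (n + 1)).dropLast = pre i n := by
  simp [pre, List.range_succ]

/-- For a Moran construction in a complete space the projection is well defined on `Γ`. -/
theorem IsMoranConstruction.iInter_eq_singleton {κ : ℕ} {M : Type*} [MetricSpace M]
    [CompleteSpace M] [Nonempty M] {Γ : Set (Shift κ)} {E : List (Fin κ) → Set M}
    (h : IsMoranConstruction Γ E) {i : Shift κ} (hi : i ∈ Γ) :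
    ⋂ n : ℕ, E (pre i (n + 1)) = {proj E i} := by
  have hw : ∀ n, pre i n ∈ words Γ := fun n => ⟨i, hi, n, rfl⟩
  have hanti : Antitone fun n => E (pre i (n + 1)) := antitone_nat_of_succ_le fun n => by
    have := h.subset _ (hw (n + 1 + 1)) (pre_succ_ne_nil i (n + 1))
    rwa [dropLast_pre_succ] at this
  have hlim := (tendsto_add_atTop_iff_nat 1).2 (h.diam_tendsto i hi)
  have hne : (⋂ n : ℕ, E (pre i (n + 1))).Nonempty := by
    refine Metric.nonempty_iInter_of_nonempty_biInter (fun n => h.isClosed _ (hw _))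
      (fun n => h.isBounded _ (hw _)) (fun N => ?_) hlim
    have hN : (E (pre i (N + 1))).Nonempty := by
      by_contra hc
      have := h.diam_pos _ (hw (N + 1))
      rw [not_nonempty_iff_eq_empty.1 hc, Metric.diam_empty] at this
      exact lt_irrefl _ this
    obtain ⟨x, hx⟩ := hN
    exact ⟨x, mem_iInter₂.2 fun n hn => hanti hn hx⟩
  have hmem : proj E i ∈ ⋂ n : ℕ, E (pre i (n + 1)) := Classical.epsilon_spec hne
  refine eq_singleton_iff_unique_mem.2 ⟨hmem, fun y hy => ?_⟩
  refine dist_le_zero.1 (ge_of_tendsto' hlim fun n => ?_)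
  exact Metric.dist_le_diam_of_mem (h.isBounded _ (hw _)) (mem_iInter.1 hy n)
    (mem_iInter.1 hmem n)

/-! ### Iterated function systems -/

/-- The maps `φ i`, restricted to `X`, form an iterated function system on `X`: injective Lipschitz
contractions of `X` into itself, two of which have distinct fixed points. -/
structure IsIFS {κ : ℕ} {M : Type*} [MetricSpace M] (X : Set M) (φ : Fin κ → M → M) : Prop where
  mapsTo : ∀ i, MapsTo (φ i) X X
  injOn : ∀ i, InjOn (φ i) X
  contraction : ∀ i, ∃ r : ℝ≥0, 0 < r ∧ r < 1 ∧ LipschitzOnWith r (φ i) X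
  fixed : ∃ i j : Fin κ, ∃ x ∈ X, ∃ y ∈ X, φ i x = x ∧ φ j y = y ∧ x ≠ y

/-- A conformal iterated function system on a closed set `X ⊆ ℝᵈ`: an iterated function system on
`X` whose maps extend to injective conformal maps of class `C^{1+ε}` (that is, with locally
`ε`-Hölder derivative) on an open neighbourhood `V` of `X`. -/
structure IsConformalIFS {κ d : ℕ} (X : Set (EuclideanSpace ℝ (Fin d)))
    (φ : Fin κ → EuclideanSpace ℝ (Fin d) → EuclideanSpace ℝ (Fin d)) : Prop where
  isClosed : IsClosed X
  isIFS : IsIFS X φ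
  conformal : ∃ V : Set (EuclideanSpace ℝ (Fin d)), IsOpen V ∧ X ⊆ V ∧ ∀ i,
    InjOn (φ i) V ∧ (∀ x ∈ V, ConformalAt (φ i) x) ∧
    ∃ ε : ℝ≥0, 0 < ε ∧ ∀ x ∈ V, ∃ U ∈ 𝓝 x, ∃ C : ℝ≥0, HolderOnWith C ε (fderiv ℝ (φ i)) U

/-- `wordMap φ [i₁, …, iₙ] = φ i₁ ∘ ⋯ ∘ φ iₙ`. -/
def wordMap {κ : ℕ} {M : Type*} (φ : Fin κ → M → M) : List (Fin κ) → M → M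
  | [] => id
  | a :: w => φ a ∘ wordMap φ w

/-! ### Assouad dimension -/

/-- There is a constant `C ≥ 1` such that each set `A ∩ B(x, R)` can be covered by at most
`C (r / R)^{-t}` closed balls of radius `r` centered at `A`, for all `0 < r < R`. -/
def IsAssouadExponent {M : Type*} [MetricSpace M] (A : Set M) (t : ℝ) : Prop :=
  ∃ C : ℝ, 1 ≤ C ∧ ∀ (x : M) (r R : ℝ), 0 < r → r < R →
    ∃ s : Finset M, (s : Set M) ⊆ A ∧ (s.card : ℝ) ≤ C * (r / R) ^ (-t) ∧
      A ∩ Metric.closedBall x R ⊆ ⋃ y ∈ s, Metric.closedBall y r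

/-- The Assouad dimension. (Only exponents `t ≥ 0` are possible for a non-empty set; the empty set
gets dimension `0`.) -/
noncomputable def assouadDim {M : Type*} [MetricSpace M] (A : Set M) : ℝ≥0∞ :=
  ⨅ (t : ℝ≥0) (_ : IsAssouadExponent A (t : ℝ)), (t : ℝ≥0∞)

end MoranMicro

namespace MoranMicro

/-! ### Hölder control of conformal maps on compact sets -/

/-! As `A` is a microset of itself, the point is that every Assouad exponent of `π(A)` is one of
`π(A')` for each microset `A'`.

Two facts carry this. Bounded distortion (`IsConformalIFS.exists_distortion`): on `W` the maps
`φ_w`, `w ∈ Γ_*`, are similarities up to a factor `D` independent of `w`. Indeed, logarithms of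
difference quotients add along compositions, each deviates from a constant by a power of the
diameter of the current image of `W`, and these diameters decay geometrically. Equivariance
(`IsMoranConstruction.wordMap_proj`): `φ_{i|n}` sends `π(σⁿ i)` to `π(i)`.

If a miniset with word `w` is close to `A'`, uniform continuity of `π` lets each point of `π(A')` be
moved by a small amount so that `φ_w` carries it into `π(A)`. This gives near-similarities of
`π(A')` into `π(A)` with additive error `η` as small as desired and `D` fixed. Covering at scale `r`
tolerates an error of order `r`, so covers pull back with a constant independent of the scales
(`IsAssouadExponent.of_approx`). -/

theorem _root_.ConformalAt.norm_fderiv_pos {E F : Type*} [NormedAddCommGroup E] [NormedSpace ℝ E]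
    [NormedAddCommGroup F] [NormedSpace ℝ F] [Nontrivial E] {f : E → F} {x : E}
    (h : ConformalAt f x) :
    0 < ‖fderiv ℝ f x‖ ∧ ∀ v, ‖fderiv ℝ f x v‖ = ‖fderiv ℝ f x‖ * ‖v‖ := by
  obtain ⟨f', hf', c, hc, li, rfl⟩ := h
  have key : ‖c • li.toContinuousLinearMap‖ = |c| := by
    rw [norm_smul, LinearIsometry.norm_toContinuousLinearMap, mul_one, Real.norm_eq_abs]
  rw [hf'.fderiv, key]
  refine ⟨abs_pos.2 hc, fun v => ?_⟩
  simp [norm_smul]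

theorem abs_log_sub_log_le {a b m : ℝ} (hm : 0 < m) (ha : m ≤ a) (hb : m ≤ b) :
    |Real.log a - Real.log b| ≤ |a - b| / m := by
  have key : ∀ x y : ℝ, m ≤ x → m ≤ y → Real.log x - Real.log y ≤ |x - y| / m := by
    intro x y hx hy
    have hx0 := hm.trans_le hx
    have hy0 := hm.trans_le hy
    rw [← Real.log_div hx0.ne' hy0.ne']
    calc Real.log (x / y) ≤ x / y - 1 := Real.log_le_sub_one_of_pos (div_pos hx0 hy0)
      _ = (x - y) / y := by field_simp
      _ ≤ |x - y| / y := by gcongr; exact le_abs_self _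
      _ ≤ |x - y| / m := by gcongr
  refine abs_le.2 ⟨?_, key a b ha hb⟩
  have := key b a hb ha
  rw [abs_sub_comm] at this
  linarith

/-- A function on pairs that is continuous off the diagonal and bounded by a multiple of a power of
the distance near the diagonal has such a bound on each compact set. -/
theorem exists_le_mul_dist_rpow {M : Type*} [MetricSpace M] {K : Set M} (hK : IsCompact K)
    {F : M × M → ℝ} {ε : ℝ}
    (hdiag : ∀ p ∈ K, ∃ C : ℝ, ∀ᶠ z in 𝓝 (p, p), z.1 ≠ z.2 → F z ≤ C * dist z.1 z.2 ^ ε)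
    (hoff : ∀ p ∈ K, ∀ q ∈ K, p ≠ q → ContinuousAt F (p, q)) :
    ∃ C : ℝ, 0 ≤ C ∧ ∀ u ∈ K, ∀ v ∈ K, u ≠ v → F (u, v) ≤ C * dist u v ^ ε := by
  suffices h : ∃ C : ℝ, ∀ z ∈ K ×ˢ K, z.1 ≠ z.2 → F z ≤ C * dist z.1 z.2 ^ ε by
    obtain ⟨C, hC⟩ := h
    refine ⟨max C 0, le_max_right _ _, fun u hu v hv huv => (hC (u, v) ⟨hu, hv⟩ huv).trans ?_⟩
    gcongr
    exact le_max_left _ _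
  -- The bound is inherited by subsets and finite unions, so compactness of `K ×ˢ K` leaves only a
  -- local check at each pair.
  refine (hK.prod hK).induction_on
    (p := fun S => ∃ C : ℝ, ∀ z ∈ S, z.1 ≠ z.2 → F z ≤ C * dist z.1 z.2 ^ ε) ⟨0, by simp⟩ ?_ ?_ ?_
  · rintro s t hst ⟨C, hC⟩
    exact ⟨C, fun z hz => hC z (hst hz)⟩
  · rintro s t ⟨C, hC⟩ ⟨C', hC'⟩
    refine ⟨max C C', fun z hz hne => ?_⟩
    rcases hz with hz | hz
    · refine (hC z hz hne).trans ?_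
      gcongr
      exact le_max_left _ _
    · refine (hC' z hz hne).trans ?_
      gcongr
      exact le_max_right _ _
  · rintro ⟨p, q⟩ ⟨hp, hq⟩
    by_cases hpq : p = q
    · subst hpq
      obtain ⟨C, hC⟩ := hdiag p hp
      exact ⟨_, mem_nhdsWithin_of_mem_nhds hC, C, fun z hz => hz⟩
    · have hd : ContinuousAt (fun z : M × M => dist z.1 z.2) (p, q) := by fun_prop
      have hpos : 0 < dist p q := dist_pos.2 hpq
      have hc : ContinuousAt (fun z : M × M => F z / dist z.1 z.2 ^ ε) (p, q) :=
        (hoff p hp q hq hpq).div (hd.rpow_const (Or.inl hpos.ne')) (Real.rpow_pos_of_pos hpos _).ne'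
      refine ⟨_, mem_nhdsWithin_of_mem_nhds (hc.eventually_lt_const (lt_add_one _)),
        F (p, q) / dist p q ^ ε + 1, fun z hz hne => ?_⟩
      exact (div_le_iff₀ (Real.rpow_pos_of_pos (dist_pos.2 hne) _)).1 (le_of_lt hz)

/-- On a compact set the logarithm of the derivative of a conformal map with locally Hölder
derivative is Hölder, and so is its difference to the logarithm of the difference quotient. -/
theorem exists_log_distortion {E : Type*} [NormedAddCommGroup E] [NormedSpace ℝ E] [Nontrivial E]
    {V K : Set E} (hV : IsOpen V) (hK : IsCompact K) (hKV : K ⊆ V) {f : E → E} (hinj : InjOn f V)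
    (hconf : ∀ x ∈ V, ConformalAt f x) {ε : ℝ≥0} (hε : 0 < ε)
    (hold : ∀ x ∈ V, ∃ U ∈ 𝓝 x, ∃ C : ℝ≥0, HolderOnWith C ε (fderiv ℝ f) U) :
    ∃ C : ℝ, 0 ≤ C ∧ ∀ u ∈ K, ∀ v ∈ K, u ≠ v →
      |Real.log (dist (f u) (f v) / dist u v) - Real.log ‖fderiv ℝ f u‖| +
        |Real.log ‖fderiv ℝ f u‖ - Real.log ‖fderiv ℝ f v‖| ≤ C * dist u v ^ (ε : ℝ) := by
  have hcont : ∀ p ∈ V, ContinuousAt (fun x => ‖fderiv ℝ f x‖) p := fun p hp => by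
    obtain ⟨U, hU, C, hC⟩ := hold p hp
    exact ((hC.continuousOn hε).continuousAt hU).norm
  have hpos : ∀ p ∈ V, 0 < ‖fderiv ℝ f p‖ := fun p hp => (hconf p hp).norm_fderiv_pos.1
  refine exists_le_mul_dist_rpow hK (F := fun z : E × E =>
    |Real.log (dist (f z.1) (f z.2) / dist z.1 z.2) - Real.log ‖fderiv ℝ f z.1‖| +
        |Real.log ‖fderiv ℝ f z.1‖ - Real.log ‖fderiv ℝ f z.2‖|) ?_ ?_
  · intro p hp
    obtain ⟨U, hU, C, hC⟩ := hold p (hKV hp)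
    set m := ‖fderiv ℝ f p‖ / 2
    have hm0 : 0 < m := half_pos (hpos p (hKV hp))
    have hlow : ∀ᶠ x in 𝓝 p, m < ‖fderiv ℝ f x‖ :=
      (hcont p (hKV hp)).eventually_const_lt (half_lt_self (hpos p (hKV hp)))
    obtain ⟨δ, hδ, hball⟩ := Metric.mem_nhds_iff.1
      (Filter.inter_mem (Filter.inter_mem hU (hV.mem_nhds (hKV hp))) hlow)
    -- This keeps the difference quotient above `m / 2`, where `log` has Lipschitz constant `2 / m`;
    -- the two logarithmic terms together give `4 * C / m`.
    have hsmall : ∀ᶠ z : E × E in 𝓝 (p, p), C * dist z.1 z.2 ^ (ε : ℝ) < m / 2 := by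
      have hd : ContinuousAt (fun z : E × E => dist z.1 z.2) (p, p) := by fun_prop
      have hc : ContinuousAt (fun z : E × E => C * dist z.1 z.2 ^ (ε : ℝ)) (p, p) :=
        continuousAt_const.mul (hd.rpow_const (Or.inr (by positivity)))
      refine hc.eventually_lt_const ?_
      have : (ε : ℝ) ≠ 0 := by positivity
      simp [Real.zero_rpow this, hm0]
    refine ⟨4 * C / m, ?_⟩
    filter_upwards [hsmall, prod_mem_nhds (Metric.ball_mem_nhds p hδ) (Metric.ball_mem_nhds p hδ)]
    rintro ⟨u, v⟩ hz ⟨hu, hv⟩ huv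
    simp only at hz hu hv huv ⊢
    have hduv : 0 < dist u v := dist_pos.2 huv
    have hH : ∀ x ∈ segment ℝ u v, ‖fderiv ℝ f x - fderiv ℝ f u‖ ≤ C * dist u v ^ (ε : ℝ) := by
      intro x hx
      have hxb := (convex_ball p δ).segment_subset hu hv hx
      rw [← dist_eq_norm]
      refine (hC.dist_le (hball hxb).1.1 (hball hu).1.1).trans ?_
      gcongr
      rw [← dist_add_dist_of_mem_segment hx, dist_comm u x]
      exact le_add_of_nonneg_right dist_nonneg
    -- Mean value inequality for `f` minus its linearization at `u`. Conformality then replaces the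
    -- norm of the linear term by `‖fderiv ℝ f u‖ * dist u v`.
    have hmv : ‖f v - f u - fderiv ℝ f u (v - u)‖ ≤ C * dist u v ^ (ε : ℝ) * ‖v - u‖ := by
      refine (convex_segment u v).norm_image_sub_le_of_norm_hasFDerivWithin_le' (fun x hx => ?_)
        hH (left_mem_segment ℝ u v) (right_mem_segment ℝ u v)
      have hxb := (convex_ball p δ).segment_subset hu hv hx
      exact (hconf x (hball hxb).1.2).differentiableAt.hasFDerivAt.hasFDerivWithinAt
    have hratio : |dist (f u) (f v) / dist u v - ‖fderiv ℝ f u‖| ≤ C * dist u v ^ (ε : ℝ) := by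
      have h1 := (abs_norm_sub_norm_le (f v - f u) (fderiv ℝ f u (v - u))).trans hmv
      rw [(hconf u (hball hu).1.2).norm_fderiv_pos.2, ← dist_eq_norm, ← dist_eq_norm,
        dist_comm (f v), dist_comm v] at h1
      rw [← mul_le_mul_iff_left₀ hduv]
      refine le_trans (le_of_eq ?_) h1
      rw [← abs_of_pos hduv, ← abs_mul, abs_of_pos hduv]
      congr 1
      field_simp
    have hder : |‖fderiv ℝ f u‖ - ‖fderiv ℝ f v‖| ≤ C * dist u v ^ (ε : ℝ) := by
      have := hH v (right_mem_segment ℝ u v)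
      rw [abs_sub_comm]
      exact (abs_norm_sub_norm_le _ _).trans this
    have hlu : m < ‖fderiv ℝ f u‖ := (hball hu).2
    have hlv : m < ‖fderiv ℝ f v‖ := (hball hv).2
    have hlr : m / 2 ≤ dist (f u) (f v) / dist u v := by
      have := (abs_le.1 hratio).1
      linarith
    have e1 := abs_log_sub_log_le (half_pos hm0) hlr (by linarith : m / 2 ≤ ‖fderiv ℝ f u‖)
    have e2 := abs_log_sub_log_le (half_pos hm0) (by linarith : m / 2 ≤ ‖fderiv ℝ f u‖)
      (by linarith : m / 2 ≤ ‖fderiv ℝ f v‖)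
    calc _ ≤ C * dist u v ^ (ε : ℝ) / (m / 2) + C * dist u v ^ (ε : ℝ) / (m / 2) :=
          add_le_add (e1.trans (by gcongr)) (e2.trans (by gcongr))
      _ = _ := by field_simp; ring
  -- Off the diagonal, injectivity keeps the difference quotient non-zero, so its logarithm is
  -- continuous.
  · intro p hp q hq hpq
    have hpV := hKV hp
    have hqV := hKV hq
    have hfp : ContinuousAt f p := (hconf p hpV).differentiableAt.continuousAt
    have hfq : ContinuousAt f q := (hconf q hqV).differentiableAt.continuousAt
    have h1 : ContinuousAt (fun z : E × E => f z.1) (p, q) := hfp.comp' continuousAt_fst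
    have h2 : ContinuousAt (fun z : E × E => f z.2) (p, q) := hfq.comp' continuousAt_snd
    have h3 : ContinuousAt (fun z : E × E => ‖fderiv ℝ f z.1‖) (p, q) :=
      ContinuousAt.comp' (f := Prod.fst) (g := fun x => ‖fderiv ℝ f x‖) (hcont p hpV)
        continuousAt_fst
    have h4 : ContinuousAt (fun z : E × E => ‖fderiv ℝ f z.2‖) (p, q) :=
      ContinuousAt.comp' (f := Prod.snd) (g := fun x => ‖fderiv ℝ f x‖) (hcont q hqV)
        continuousAt_snd
    have h5 : ContinuousAt (fun z : E × E => dist z.1 z.2) (p, q) := by fun_prop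
    have hne : f p ≠ f q := fun h => hpq (hinj hpV hqV h)
    have h6 := (h1.dist h2).div h5 (dist_ne_zero.2 hpq)
    have h7 := h6.log (div_ne_zero (dist_ne_zero.2 hne) (dist_ne_zero.2 hpq))
    exact ((h7.sub (h3.log (hpos p hpV).ne')).abs).add
      (((h3.log (hpos p hpV).ne').sub (h4.log (hpos q hqV).ne')).abs)

/-! ### Assouad exponents -/

theorem isAssouadExponent_empty {M : Type*} [MetricSpace M] (t : ℝ) :
    IsAssouadExponent (∅ : Set M) t :=
  ⟨1, le_rfl, fun _ r R hr hR => ⟨∅, by simp, by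
    have := Real.rpow_nonneg (div_pos hr (hr.trans hR)).le (-t)
    simpa using this, by simp⟩⟩

/-- If `Q` is, at arbitrarily small precision `η`, mapped into `P` by maps that are similarities up
to a uniform multiplicative constant, then Assouad exponents of `P` are exponents of `Q`. -/
theorem IsAssouadExponent.of_approx {M : Type*} [MetricSpace M] {P Q : Set M} {t : ℝ} (ht : 0 ≤ t)
    (hP : IsAssouadExponent P t) {D : ℝ} (hD : 1 ≤ D)
    (h : ∀ η : ℝ, 0 < η → ∃ (f : M → M) (Λ : ℝ), 0 < Λ ∧ MapsTo f Q P ∧ ∀ p ∈ Q, ∀ q ∈ Q,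
      Λ / D * (dist p q - η) ≤ dist (f p) (f q) ∧ dist (f p) (f q) ≤ Λ * D * (dist p q + η)) :
    IsAssouadExponent Q t := by
  classical
  obtain ⟨C, hC, hcov⟩ := hP
  have hD0 : 0 < D := zero_lt_one.trans_le hD
  have hk : 1 ≤ 12 * D ^ 2 := by nlinarith
  refine ⟨C * (12 * D ^ 2) ^ t, one_le_mul_of_one_le_of_one_le hC (Real.one_le_rpow hk ht),
    fun x r R hr hR => ?_⟩
  have hR0 : 0 < R := hr.trans hR
  by_cases hne : (Q ∩ Metric.closedBall x R).Nonempty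
  swap
  · refine ⟨∅, by simp, ?_, ?_⟩
    · have : 0 ≤ (r / R) ^ (-t) := by positivity
      simp only [Finset.card_empty, Nat.cast_zero]
      positivity
    · rw [not_nonempty_iff_eq_empty.1 hne]; simp
  obtain ⟨p₀, hp₀, hp₀x⟩ := hne
  -- Points of `Q` whose images share a ball of radius `Λ r / (4 D)` are at distance at most `r / 2
  -- + η = r`. The image of `Q ∩ B(x, R)` lies within `Λ D (2 R + η) ≤ 3 Λ D R` of `f p₀`. The
  -- quotient of the two radii produces `12 D²`.
  obtain ⟨f, Λ, hΛ, hf, hfd⟩ := h (r / 2) (half_pos hr)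
  have hρ : 0 < Λ / D * (r / 4) := by positivity
  have hratio : Λ / D * (r / 4) / (Λ * D * (3 * R)) = (r / R) / (12 * D ^ 2) := by
    field_simp; ring
  have hlt : Λ / D * (r / 4) < Λ * D * (3 * R) := by
    rw [← div_lt_one (by positivity), hratio, div_lt_one (by positivity)]
    exact ((div_lt_one hR0).2 hR).trans_le hk
  obtain ⟨s, -, hcard, hs⟩ := hcov (f p₀) _ _ hρ hlt
  -- The centers found in `P` need not be images of points of `Q`, so each useful ball is
  -- represented by a point of `Q` mapped into it; `p₀` is a dummy for the other balls.
  have hsel : ∀ y : M, ∃ q : M, q ∈ Q ∧ ((∃ p ∈ Q ∩ Metric.closedBall x R,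
      f p ∈ Metric.closedBall y (Λ / D * (r / 4))) →
        f q ∈ Metric.closedBall y (Λ / D * (r / 4))) := by
    intro y
    by_cases hy : ∃ p ∈ Q ∩ Metric.closedBall x R, f p ∈ Metric.closedBall y (Λ / D * (r / 4))
    · obtain ⟨p, hp, hpy⟩ := hy
      exact ⟨p, hp.1, fun _ => hpy⟩
    · exact ⟨p₀, hp₀, fun h => absurd h hy⟩
  choose g hgQ hg using hsel
  refine ⟨s.image g, ?_, ?_, ?_⟩
  · intro q hq
    obtain ⟨y, -, rfl⟩ := Finset.mem_image.1 (Finset.mem_coe.1 hq)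
    exact hgQ y
  · calc ((s.image g).card : ℝ) ≤ s.card := by exact_mod_cast Finset.card_image_le
      _ ≤ _ := hcard
      _ = C * ((r / R) / (12 * D ^ 2)) ^ (-t) := by rw [hratio]
      _ = _ := by
        rw [Real.div_rpow (by positivity) (by positivity), Real.rpow_neg (by positivity) t,
          Real.rpow_neg (by positivity : 0 ≤ 12 * D ^ 2) t]
        field_simp
  · rintro p ⟨hp, hpx⟩
    have hpp₀ : dist p p₀ ≤ 2 * R := by
      rw [Metric.mem_closedBall] at hpx hp₀x
      linarith [dist_triangle_right p p₀ x]
    have hfp : f p ∈ P ∩ Metric.closedBall (f p₀) (Λ * D * (3 * R)) := by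
      refine ⟨hf hp, (hfd p hp p₀ hp₀).2.trans ?_⟩
      gcongr
      linarith
    obtain ⟨y, hy, hpy⟩ := mem_iUnion₂.1 (hs hfp)
    have hgy := hg y ⟨p, ⟨hp, hpx⟩, hpy⟩
    refine mem_iUnion₂.2 ⟨g y, Finset.mem_image_of_mem g hy, ?_⟩
    rw [Metric.mem_closedBall] at hpy hgy ⊢
    have h1 := (hfd p hp (g y) (hgQ y)).1
    have h2 := dist_triangle_right (f p) (f (g y)) y
    have h3 : Λ / D * (dist p (g y) - r / 2) ≤ Λ / D * (r / 2) := by linarith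
    have := le_of_mul_le_mul_left h3 (by positivity)
    linarith

/-! ### Words -/

theorem pre_zero {κ : ℕ} (i : Shift κ) : pre i 0 = [] := rfl

theorem pre_succ' {κ : ℕ} (i : Shift κ) (n : ℕ) : pre i (n + 1) = i 0 :: pre (leftShift i) n := by
  simp only [pre, List.range_succ_eq_map, List.map_cons, List.map_map]
  rfl

theorem length_pre {κ : ℕ} (i : Shift κ) (n : ℕ) : (pre i n).length = n := by simp [pre]

theorem pre_add {κ : ℕ} (i : Shift κ) (m n : ℕ) :
    pre i (m + n) = pre i m ++ pre (leftShift^[m] i) n := by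
  induction m generalizing i with
  | zero => simp [pre_zero]
  | succ m ih => rw [add_right_comm, pre_succ', ih, pre_succ']; rfl

theorem wordMap_append {κ : ℕ} {M : Type*} (φ : Fin κ → M → M) (v w : List (Fin κ)) :
    wordMap φ (v ++ w) = wordMap φ v ∘ wordMap φ w := by
  induction v with
  | nil => rfl
  | cons a v ih => simp only [List.cons_append, wordMap, ih, Function.comp_assoc]

theorem mem_words_of_cons {κ : ℕ} {Γ : Set (Shift κ)} (hσ : leftShift '' Γ ⊆ Γ) {a : Fin κ}
    {w : List (Fin κ)} (h : a :: w ∈ words Γ) : w ∈ words Γ := by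
  obtain ⟨i, hi, n, hn⟩ := h
  cases n with
  | zero => simp [pre_zero] at hn
  | succ n =>
    rw [pre_succ', List.cons.injEq] at hn
    exact ⟨_, hσ ⟨i, hi, rfl⟩, n, hn.2⟩

theorem iterate_leftShift_mem {κ : ℕ} {Γ : Set (Shift κ)} (hσ : leftShift '' Γ ⊆ Γ) {i : Shift κ}
    (hi : i ∈ Γ) (n : ℕ) : leftShift^[n] i ∈ Γ :=
  (mapsTo_iff_image_subset.2 hσ).iterate n hi

theorem pre_eq_of_dist_lt {κ : ℕ} {i j : Shift κ} {n : ℕ} (h : dist i j < (1 / 2) ^ n) :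
    pre i n = pre j n :=
  List.map_congr_left fun _ hk => PiNat.apply_eq_of_dist_lt h (List.mem_range.1 hk).le

theorem isMicroset_self {κ : ℕ} {Γ A : Set (Shift κ)} (hAΓ : A ⊆ Γ) (hA : IsCompact A) :
    IsMicroset Γ A A := by
  refine ⟨hAΓ, hA, fun _ => A, fun _ => ⟨[], ?_⟩, by simp⟩
  have : cylinder ([] : List (Fin κ)) = univ := eq_univ_of_forall fun i => rfl
  simp [magnify, this]

theorem IsIFS.exists_lipschitz {κ : ℕ} {M : Type*} [MetricSpace M] {X : Set M}
    {φ : Fin κ → M → M} (h : IsIFS X φ) :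
    ∃ r : ℝ≥0, r < 1 ∧ ∀ i, LipschitzOnWith r (φ i) X := by
  choose r _ hr1 hr using h.contraction
  exact ⟨Finset.univ.sup r, (Finset.sup_lt_iff zero_lt_one).2 fun i _ => hr1 i,
    fun i => (hr i).weaken (Finset.le_sup (Finset.mem_univ i))⟩

theorem IsIFS.mapsTo_wordMap {κ : ℕ} {M : Type*} [MetricSpace M] {X : Set M}
    {φ : Fin κ → M → M} (h : IsIFS X φ) (w : List (Fin κ)) : MapsTo (wordMap φ w) X X := by
  induction w with
  | nil => exact mapsTo_id X
  | cons a w ih => exact (h.mapsTo a).comp ih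

theorem IsIFS.injOn_wordMap {κ : ℕ} {M : Type*} [MetricSpace M] {X : Set M}
    {φ : Fin κ → M → M} (h : IsIFS X φ) (w : List (Fin κ)) : InjOn (wordMap φ w) X := by
  induction w with
  | nil => exact injOn_id X
  | cons a w ih => exact (h.injOn a).comp ih (h.mapsTo_wordMap w)

theorem IsIFS.dist_wordMap_le {κ : ℕ} {M : Type*} [MetricSpace M] {X : Set M}
    {φ : Fin κ → M → M} (h : IsIFS X φ) {r : ℝ≥0} (hr : ∀ i, LipschitzOnWith r (φ i) X)
    (w : List (Fin κ)) {x y : M} (hx : x ∈ X) (hy : y ∈ X) :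
    dist (wordMap φ w x) (wordMap φ w y) ≤ r ^ w.length * dist x y := by
  induction w with
  | nil => simp [wordMap]
  | cons a w ih =>
    calc _ ≤ r * dist (wordMap φ w x) (wordMap φ w y) :=
          (hr a).dist_le_mul _ (h.mapsTo_wordMap w hx) _ (h.mapsTo_wordMap w hy)
      _ ≤ r * (r ^ w.length * dist x y) := by gcongr
      _ = _ := by rw [List.length_cons]; ring

/-! ### Moran constructions given by iterated function systems -/

theorem IsMoranConstruction.antitone_pre {κ : ℕ} {M : Type*} [MetricSpace M]
    {Γ : Set (Shift κ)} {E : List (Fin κ) → Set M} (h : IsMoranConstruction Γ E) {i : Shift κ}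
    (hi : i ∈ Γ) : Antitone fun n => E (pre i n) := antitone_nat_of_succ_le fun n => by
  have := h.subset _ ⟨i, hi, n + 1, rfl⟩ (pre_succ_ne_nil i n)
  rwa [dropLast_pre_succ] at this

section

variable {κ : ℕ} {M : Type*} [MetricSpace M] {Γ : Set (Shift κ)} {φ : Fin κ → M → M} {W : Set M}

theorem IsMoranConstruction.mapsTo_wordMap
    (hW : IsMoranConstruction Γ fun w => wordMap φ w '' W) {w : List (Fin κ)} (hw : w ∈ words Γ) :
    MapsTo (wordMap φ w) W W := by
  obtain ⟨i, hi, n, rfl⟩ := hw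
  rw [mapsTo_iff_image_subset]
  have := hW.antitone_pre hi (Nat.zero_le n)
  simpa [pre_zero, wordMap] using this

theorem IsMoranConstruction.proj_mem [CompleteSpace M] [Nonempty M]
    (hW : IsMoranConstruction Γ fun w => wordMap φ w '' W) {i : Shift κ} (hi : i ∈ Γ) (n : ℕ) :
    proj (fun w => wordMap φ w '' W) i ∈ wordMap φ (pre i n) '' W := by
  have h : proj (fun w => wordMap φ w '' W) i ∈ ⋂ n : ℕ, wordMap φ (pre i (n + 1)) '' W := by
    rw [hW.iInter_eq_singleton hi]; rfl
  exact hW.antitone_pre hi n.le_succ (mem_iInter.1 h n)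

theorem IsMoranConstruction.proj_mem_base [CompleteSpace M] [Nonempty M]
    (hW : IsMoranConstruction Γ fun w => wordMap φ w '' W) {i : Shift κ} (hi : i ∈ Γ) :
    proj (fun w => wordMap φ w '' W) i ∈ W := by
  simpa [pre_zero, wordMap] using hW.proj_mem hi 0

theorem IsMoranConstruction.wordMap_proj [CompleteSpace M] [Nonempty M]
    (hW : IsMoranConstruction Γ fun w => wordMap φ w '' W) (hσ : leftShift '' Γ ⊆ Γ)
    {i : Shift κ} (hi : i ∈ Γ) (n : ℕ) :
    wordMap φ (pre i n) (proj (fun w => wordMap φ w '' W) (leftShift^[n] i)) =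
      proj (fun w => wordMap φ w '' W) i := by
  have h := hW.iInter_eq_singleton hi
  rw [← mem_singleton_iff, ← h, mem_iInter]
  intro m
  -- By nestedness it suffices to reach the deeper level `n + (m + 1)`, where the word splits as
  -- `i|ₙ` followed by a prefix of `σⁿ i`.
  refine hW.antitone_pre hi (Nat.le_add_left (m + 1) n) ?_
  beta_reduce
  rw [pre_add i n (m + 1), wordMap_append, image_comp]
  exact mem_image_of_mem _ (hW.proj_mem (iterate_leftShift_mem hσ hi n) _)

/-- The projection of a Moran construction is uniformly continuous on `Γ`. -/
theorem IsMoranConstruction.exists_dist_proj_lt [CompleteSpace M] [Nonempty M] {X : Set M}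
    (hφ : IsIFS X φ) (hWX : W ⊆ X) (hWb : Bornology.IsBounded W)
    (hW : IsMoranConstruction Γ fun w => wordMap φ w '' W) {η : ℝ} (hη : 0 < η) :
    ∃ δ > 0, ∀ i ∈ Γ, ∀ j ∈ Γ, dist i j < δ →
      dist (proj (fun w => wordMap φ w '' W) i) (proj (fun w => wordMap φ w '' W) j) < η := by
  obtain ⟨r, hr1, hr⟩ := hφ.exists_lipschitz
  have hlim : Tendsto (fun n : ℕ => (r : ℝ) ^ n * Metric.diam W) atTop (𝓝 (0 * Metric.diam W)) :=
    (tendsto_pow_atTop_nhds_zero_of_lt_one r.coe_nonneg hr1).mul_const _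
  rw [zero_mul] at hlim
  obtain ⟨n, hn⟩ := (hlim.eventually_lt_const hη).exists
  refine ⟨(1 / 2) ^ n, by positivity, fun i hi j hj hij => ?_⟩
  obtain ⟨x, hx, hxi⟩ := hW.proj_mem hi n
  obtain ⟨y, hy, hyj⟩ := hW.proj_mem hj n
  rw [← pre_eq_of_dist_lt hij] at hyj
  rw [← hxi, ← hyj]
  refine lt_of_le_of_lt ((hφ.dist_wordMap_le hr _ (hWX hx) (hWX hy)).trans ?_) hn
  rw [length_pre]
  gcongr
  exact Metric.dist_le_diam_of_mem hWb hx hy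

end

/-! ### Bounded distortion -/

/-- Telescoping over the letters. A tail of length `k` maps `W` into itself, with image of diameter
at most `r ^ k * diam W`, so the next letter's difference quotient is nearly constant there. `G`
does not depend on `x` and `y`, and the error depends on `w` only through its length. -/
theorem exists_abs_log_wordMap_sub_le {κ : ℕ} {M : Type*} [MetricSpace M] {Γ : Set (Shift κ)}
    {X W : Set M} {φ : Fin κ → M → M} (hφ : IsIFS X φ) (hσ : leftShift '' Γ ⊆ Γ) (hWX : W ⊆ X)
    (hWb : Bornology.IsBounded W) (hW : IsMoranConstruction Γ fun w => wordMap φ w '' W)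
    {r : ℝ≥0} (hr : ∀ i, LipschitzOnWith r (φ i) X) {z : M} (hz : z ∈ W) {g : Fin κ → M → ℝ}
    {C ε : Fin κ → ℝ} (hC : ∀ a, 0 ≤ C a) (hε : ∀ a, 0 < ε a)
    (h : ∀ a, ∀ u ∈ W, ∀ v ∈ W, u ≠ v →
      |Real.log (dist (φ a u) (φ a v) / dist u v) - g a u| + |g a u - g a v| ≤
        C a * dist u v ^ ε a) {w : List (Fin κ)} (hw : w ∈ words Γ) :
    ∃ G : ℝ, ∀ x ∈ W, ∀ y ∈ W, x ≠ y →
      |Real.log (dist (wordMap φ w x) (wordMap φ w y) / dist x y) - G| ≤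
        ∑ k ∈ Finset.range w.length, ∑ a, 2 * (C a * (r ^ k * Metric.diam W) ^ ε a) := by
  induction w with
  | nil =>
    refine ⟨0, fun x _ y _ hxy => ?_⟩
    simp [wordMap, div_self (dist_ne_zero.2 hxy)]
  | cons a w ih =>
    have hw' := mem_words_of_cons hσ hw
    obtain ⟨G, hG⟩ := ih hw'
    -- The base point `z` makes the constant uniform. One error term compares the quotient with `g
    -- a` at the image of `x`, a second moves from there to the image of `z`: hence the factor 2.
    refine ⟨g a (wordMap φ w z) + G, fun x hx y hy hxy => ?_⟩
    have hmaps := hW.mapsTo_wordMap hw'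
    have hne : wordMap φ w x ≠ wordMap φ w y :=
      fun he => hxy (hφ.injOn_wordMap w (hWX hx) (hWX hy) he)
    have hne' : φ a (wordMap φ w x) ≠ φ a (wordMap φ w y) :=
      fun he => hne (hφ.injOn a (hWX (hmaps hx)) (hWX (hmaps hy)) he)
    have hd : ∀ y ∈ W, C a * dist (wordMap φ w x) (wordMap φ w y) ^ ε a ≤
        C a * (r ^ w.length * Metric.diam W) ^ ε a := by
      intro y hy
      have h1 := hφ.dist_wordMap_le hr w (hWX hx) (hWX hy)
      have h2 := Metric.dist_le_diam_of_mem hWb hx hy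
      have h3 := hC a
      have h4 := (hε a).le
      gcongr
      exact h1.trans (by gcongr)
    have hsplit : Real.log (dist (wordMap φ (a :: w) x) (wordMap φ (a :: w) y) / dist x y) =
        Real.log (dist (φ a (wordMap φ w x)) (φ a (wordMap φ w y)) /
          dist (wordMap φ w x) (wordMap φ w y)) +
        Real.log (dist (wordMap φ w x) (wordMap φ w y) / dist x y) := by
      have e1 := dist_ne_zero.2 hxy
      have e2 := dist_ne_zero.2 hne
      have e3 := dist_ne_zero.2 hne'
      rw [← Real.log_mul (div_ne_zero e3 e2) (div_ne_zero e2 e1), div_mul_div_cancel₀ e2]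
      rfl
    have b1 := (h a _ (hmaps hx) _ (hmaps hy) hne).trans (hd y hy)
    have b2 : |g a (wordMap φ w x) - g a (wordMap φ w z)| ≤
        C a * (r ^ w.length * Metric.diam W) ^ ε a := by
      by_cases he : wordMap φ w x = wordMap φ w z
      · rw [he, sub_self, abs_zero]
        exact mul_nonneg (hC a) (Real.rpow_nonneg (by positivity) _)
      · exact (le_add_of_nonneg_left (abs_nonneg _)).trans
          ((h a _ (hmaps hx) _ (hmaps hz) he).trans (hd z hz))
    have b3 := hG x hx y hy hxy
    -- Summing over all letters makes the bound independent of which letter `a` is.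
    have b4 : 2 * (C a * (r ^ w.length * Metric.diam W) ^ ε a) ≤
        ∑ a, 2 * (C a * (r ^ w.length * Metric.diam W) ^ ε a) :=
      Finset.single_le_sum (f := fun a => 2 * (C a * (r ^ w.length * Metric.diam W) ^ ε a))
        (fun a _ => mul_nonneg zero_le_two (mul_nonneg (hC a) (Real.rpow_nonneg (by positivity) _)))
        (Finset.mem_univ a)
    have b5 := abs_nonneg (g a (wordMap φ w x) - g a (wordMap φ w y))
    rw [hsplit, List.length_cons, Finset.sum_range_succ]
    rw [abs_le] at b2 b3 ⊢
    have b6 := abs_le.1 ((le_add_of_nonneg_right b5).trans b1)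
    constructor <;> linarith [b2.1, b2.2, b3.1, b3.2, b6.1, b6.2]

/-- Bounded distortion: on `W` the maps `wordMap φ w`, where `w` is a word of `Γ`, are similarities
up to a uniform multiplicative constant. -/
theorem IsConformalIFS.exists_distortion {κ d : ℕ} {X : Set (EuclideanSpace ℝ (Fin d))}
    {φ : Fin κ → EuclideanSpace ℝ (Fin d) → EuclideanSpace ℝ (Fin d)} (hφ : IsConformalIFS X φ)
    {Γ : Set (Shift κ)} (hσ : leftShift '' Γ ⊆ Γ) {W : Set (EuclideanSpace ℝ (Fin d))}
    (hWX : W ⊆ X) (hWc : IsCompact W) (hW : IsMoranConstruction Γ fun w => wordMap φ w '' W) :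
    ∃ D : ℝ, 1 ≤ D ∧ ∀ w ∈ words Γ, ∃ Λ : ℝ, 0 < Λ ∧ ∀ x ∈ W, ∀ y ∈ W,
      Λ / D * dist x y ≤ dist (wordMap φ w x) (wordMap φ w y) ∧
      dist (wordMap φ w x) (wordMap φ w y) ≤ Λ * D * dist x y := by
  rcases W.eq_empty_or_nonempty with rfl | ⟨z, hz⟩
  · exact ⟨1, le_rfl, fun w _ => ⟨1, one_pos, by simp⟩⟩
  have hI := hφ.isIFS
  obtain ⟨V, hV, hXV, hconf⟩ := hφ.conformal
  -- Distinct fixed points rule out `d = 0`, where derivatives would have norm zero.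
  have : Nontrivial (EuclideanSpace ℝ (Fin d)) := by
    obtain ⟨-, -, x, -, y, -, -, -, hxy⟩ := hI.fixed
    exact ⟨x, y, hxy⟩
  obtain ⟨r, hr1, hr⟩ := hI.exists_lipschitz
  choose hinj hcf ε hε hold using hconf
  choose C hC hlog using fun a =>
    exists_log_distortion hV hWc (hWX.trans hXV) (hinj a) (hcf a) (hε a) (hold a)
  set e : ℕ → ℝ := fun k => ∑ a, 2 * (C a * (r ^ k * Metric.diam W) ^ (ε a : ℝ))
  have he0 : ∀ k, 0 ≤ e k := fun k => Finset.sum_nonneg fun a _ =>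
    mul_nonneg zero_le_two (mul_nonneg (hC a) (Real.rpow_nonneg (by positivity) _))
  have hsum : Summable e := by
    refine summable_sum fun a _ => ((Summable.mul_left _ ?_).mul_left 2)
    -- For each letter the errors form a geometric series of ratio `r ^ ε a < 1`.
    have hpow : ∀ k : ℕ, ((r : ℝ) ^ k * Metric.diam W) ^ (ε a : ℝ) =
        ((r : ℝ) ^ (ε a : ℝ)) ^ k * Metric.diam W ^ (ε a : ℝ) := fun k => by
      rw [Real.mul_rpow (by positivity) Metric.diam_nonneg, Real.rpow_pow_comm r.coe_nonneg]
    simp only [hpow]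
    exact (summable_geometric_of_lt_one (by positivity)
      (Real.rpow_lt_one r.coe_nonneg hr1 (hε a))).mul_right _
  refine ⟨Real.exp (∑' k, e k), Real.one_le_exp (tsum_nonneg he0), fun w hw => ?_⟩
  obtain ⟨G, hG⟩ := exists_abs_log_wordMap_sub_le hI hσ hWX hWc.isBounded hW hr hz hC
    (fun a => hε a) hlog hw
  refine ⟨Real.exp G, Real.exp_pos G, fun x hx y hy => ?_⟩
  by_cases hxy : x = y
  · simp [hxy]
  have hd : 0 < dist x y := dist_pos.2 hxy
  have hq : 0 < dist (wordMap φ w x) (wordMap φ w y) / dist x y :=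
    div_pos (dist_pos.2 fun h => hxy (hI.injOn_wordMap w (hWX hx) (hWX hy) h)) hd
  have hb : -∑' k, e k ≤ _ ∧ _ ≤ ∑' k, e k := abs_le.1
    ((hG x hx y hy hxy).trans (hsum.sum_le_tsum _ fun k _ => he0 k))
  rw [← Real.exp_sub, ← Real.exp_add, ← le_div_iff₀ hd, ← div_le_iff₀ hd,
    ← Real.le_log_iff_exp_le hq, ← Real.log_le_iff_le_exp hq]
  constructor <;> linarith [hb.1, hb.2]

/-! ### Microsets -/

theorem IsMicroset.isAssouadExponent_proj {κ d : ℕ} {X : Set (EuclideanSpace ℝ (Fin d))}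
    {φ : Fin κ → EuclideanSpace ℝ (Fin d) → EuclideanSpace ℝ (Fin d)} (hφ : IsConformalIFS X φ)
    {Γ : Set (Shift κ)} (hσ : leftShift '' Γ ⊆ Γ) {W : Set (EuclideanSpace ℝ (Fin d))}
    (hWX : W ⊆ X) (hW : IsMoranConstruction Γ fun w => wordMap φ w '' W) {A A' : Set (Shift κ)}
    (hAΓ : A ⊆ Γ) (hA' : IsMicroset Γ A A') {t : ℝ} (ht : 0 ≤ t)
    (h : IsAssouadExponent (proj (fun w => wordMap φ w '' W) '' A) t) :
    IsAssouadExponent (proj (fun w => wordMap φ w '' W) '' A') t := by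
  obtain ⟨hA'Γ, -, B, hB, hlim⟩ := hA'
  rcases A'.eq_empty_or_nonempty with rfl | ⟨i₀, hi₀⟩
  · rw [image_empty]
    exact isAssouadExponent_empty t
  have hnil : [] ∈ words Γ := ⟨i₀, hA'Γ hi₀, 0, rfl⟩
  have hWc : IsCompact W := by
    have h1 := hW.isClosed [] hnil
    have h2 := hW.isBounded [] hnil
    simp only [wordMap, image_id] at h1 h2
    exact Metric.isCompact_of_isClosed_isBounded h1 h2
  obtain ⟨D, hD, hdist⟩ := hφ.exists_distortion hσ hWX hWc hW
  set π := proj (fun w => wordMap φ w '' W)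
  refine h.of_approx ht hD fun η hη => ?_
  obtain ⟨δ, hδ, hcont⟩ := hW.exists_dist_proj_lt hφ.isIFS hWX hWc.isBounded (half_pos hη)
  obtain ⟨n, hn⟩ := (hlim.eventually_lt_const (ENNReal.ofReal_pos.2 hδ)).exists
  obtain ⟨w, hw⟩ := hB n
  -- Only one half of Hausdorff closeness is needed: every point of `A'` is near the miniset.
  rw [Metric.hausdorffEDist_comm] at hn
  have hnear : ∀ i ∈ A', ∃ k ∈ A ∩ cylinder w, dist i (leftShift^[w.length] k) < δ := by
    intro i hi
    obtain ⟨j, hj, hij⟩ := Metric.exists_edist_lt_of_hausdorffEDist_lt hi hn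
    rw [hw] at hj
    obtain ⟨k, hk, rfl⟩ := hj
    exact ⟨k, hk, by rwa [edist_lt_ofReal] at hij⟩
  have hpt : ∀ q : EuclideanSpace ℝ (Fin d), ∃ p, q ∈ π '' A' →
      p ∈ W ∧ wordMap φ w p ∈ π '' A ∧ dist q p < η / 2 := by
    intro q
    by_cases hq : q ∈ π '' A'
    · obtain ⟨i, hi, rfl⟩ := hq
      obtain ⟨k, ⟨hkA, hkw⟩, hik⟩ := hnear i hi
      have hkσ := iterate_leftShift_mem hσ (hAΓ hkA) w.length
      refine ⟨π (leftShift^[w.length] k), fun _ =>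
        ⟨hW.proj_mem_base hkσ, ⟨k, hkA, ?_⟩, hcont i (hA'Γ hi) _ hkσ hik⟩⟩
      have := hW.wordMap_proj hσ (hAΓ hkA) w.length
      rw [show pre k w.length = w from hkw] at this
      exact this.symm
    · exact ⟨q, fun h => absurd h hq⟩
  choose f hf using hpt
  -- Since `A'` is non-empty, the nearby miniset is too, so `w` is a prefix of an element of `A` and
  -- the distortion bound applies to it.
  have hwΓ : w ∈ words Γ := by
    obtain ⟨k, ⟨hkA, hkw⟩, -⟩ := hnear i₀ hi₀
    exact ⟨k, hAΓ hkA, w.length, hkw.symm⟩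
  obtain ⟨Λ, hΛ, hΛd⟩ := hdist w hwΓ
  have hD0 : 0 < D := zero_lt_one.trans_le hD
  -- Moving both endpoints by less than `η / 2` changes their distance by at most `η`.
  refine ⟨fun q => wordMap φ w (f q), Λ, hΛ, fun q hq => (hf q hq).2.1, fun p hp q hq => ?_⟩
  obtain ⟨hpW, -, hpd⟩ := hf p hp
  obtain ⟨hqW, -, hqd⟩ := hf q hq
  obtain ⟨h1, h2⟩ := hΛd _ hpW _ hqW
  have h3 := dist_triangle4 p (f p) (f q) q
  have h4 := dist_triangle4 (f p) p q (f q)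
  rw [dist_comm (f q) q] at h3
  rw [dist_comm (f p) p] at h4
  constructor
  · refine le_trans ?_ h1
    gcongr
    linarith
  · refine h2.trans ?_
    gcongr
    linarith

end MoranMicro

theorem mainTheorem9 {κ d : ℕ} (hκ : 2 ≤ κ) (X : Set (EuclideanSpace ℝ (Fin d)))
    (φ : Fin κ → EuclideanSpace ℝ (Fin d) → EuclideanSpace ℝ (Fin d))
    (hφ : MoranMicro.IsConformalIFS X φ)
    (Γ : Set (MoranMicro.Shift κ)) (hΓ : IsCompact Γ)
    (hσ : MoranMicro.leftShift '' Γ ⊆ Γ)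
    (W : Set (EuclideanSpace ℝ (Fin d))) (hWX : W ⊆ X)
    (hW : MoranMicro.IsMoranConstruction Γ (fun w => MoranMicro.wordMap φ w '' W))
    (A : Set (MoranMicro.Shift κ)) (hAΓ : A ⊆ Γ) (hA : IsCompact A) :
    MoranMicro.assouadDim (MoranMicro.proj (fun w => MoranMicro.wordMap φ w '' W) '' A) =
      ⨆ (A' : Set (MoranMicro.Shift κ)) (_ : MoranMicro.IsMicroset Γ A A'),
        MoranMicro.assouadDim
          (MoranMicro.proj (fun w => MoranMicro.wordMap φ w '' W) '' A') := by
  refine le_antisymm ?_ ?_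
  · exact le_iSup₂_of_le A (MoranMicro.isMicroset_self hAΓ hA) le_rfl
  · exact iSup₂_le fun A' hA' => le_iInf₂ fun t ht =>
      iInf₂_le t (hA'.isAssouadExponent_proj hφ hσ hWX hW hAΓ t.coe_nonneg ht)
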